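/- Let $G$ be a tree, that is, a finite simple connected acyclic graph with non-empty vertex set $V$, and let $R = K[x_v : v \in V]$ be the polynomial ring over a field $K$. For a vertex $i$ let $N[i]$ be its closed neighborhood, consisting of $i$ and all vertices adjacent to $i$, and let $NI(G) = \bigl(\prod_{j \in N[i]} x_j : i \in V\bigr) \subseteq R$ be the closed neighborhood ideal of $G$. Then $NI(G)$ is normally torsion-free, that is, $\mathrm{Ass}(R/NI(G)^k) \subseteq \mathrm{Ass}(R/NI(G))$ for all integers $k \ge 1$; moreover $\mathrm{Ass}(R/NI(G)^k) = \mathrm{Min}(NI(G))$ for all integers $k \ge 1$, where $\mathrm{Ass}$ denotes the set of associated primes and $\mathrm{Min}(I)$ the set of minimal prime ideals of $I$. -/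

import Mathlib

/-- The closed neighborhood `N[v]` of a vertex `v`: the vertex `v` together with its neighbors. -/
def SimpleGraph.closedNeighborhood {V : Type*} [Fintype V] [DecidableEq V]
    (G : SimpleGraph V) [DecidableRel G.Adj] (v : V) : Finset V :=
  insert v (G.neighborFinset v)

/-- The closed neighborhood ideal `NI(G)` in the polynomial ring over `K` with one variable for
each vertex, generated by the monomials `∏ j ∈ N[i], x_j` for `i` a vertex. -/
noncomputable def SimpleGraph.closedNeighborhoodIdeal (K : Type*) [Field K] {V : Type*}
    [Fintype V] [DecidableEq V] (G : SimpleGraph V) [DecidableRel G.Adj] :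
    Ideal (MvPolynomial V K) :=
  Ideal.span (Set.range fun i : V => ∏ j ∈ G.closedNeighborhood i, MvPolynomial.X j)

/-- An ideal `I` of a commutative Noetherian ring `R` is normally torsion-free if
`Ass(R/I^k) ⊆ Ass(R/I)` for all `k ≥ 1`. -/
def Ideal.IsNormallyTorsionFree {R : Type*} [CommRing R] [IsNoetherianRing R]
    (I : Ideal R) : Prop :=
  ∀ k : ℕ, 1 ≤ k → associatedPrimes R (R ⧸ I ^ k) ⊆ associatedPrimes R (R ⧸ I)

/-! Root the tree and order closed neighborhoods by the depth of their centers. Among the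
neighborhoods no deeper than `N[i]`, those through a given point of `N[i]` form a chain as the point
varies, so a greedy argument gives integral packing = covering for all weights on the vertices. Take
the exponent `d` of a monomial as weight. If every minimal cover `C` has `d`-weight at least `k`,
then `k` generators, with repetition, have a product dividing the monomial. Hence `NI(G)^k` is the
intersection over `C` of the ideals of order at least `k` along `C`, and each of these contributes
only the prime generated by the variables of `C`. -/

open Finset in
/-- Weighted packing equals weighted covering for a family `e` of finite sets such that, for every
`i`, the sets of `j` with `d j ≤ d i` whose member `e j` contains a given point of `e i` form a
chain. -/
theorem exists_packing_cover_of_nested {ι V : Type*} [DecidableEq ι] [DecidableEq V]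
    (e : ι → Finset V) (d : ι → ℕ) (hne : ∀ i, (e i).Nonempty)
    (hnest : ∀ i, ∀ u ∈ e i, ∀ v ∈ e i,
      (∀ j, d j ≤ d i → u ∈ e j → v ∈ e j) ∨ (∀ j, d j ≤ d i → v ∈ e j → u ∈ e j))
    (S : Finset ι) : ∀ w : V → ℕ, ∃ (b : ι → ℕ) (D : Finset V),
      (∀ i ∈ S, ∃ v ∈ e i, v ∈ D) ∧ (∀ v, ∑ i ∈ S with v ∈ e i, b i ≤ w v) ∧
        ∑ v ∈ D, w v ≤ ∑ i ∈ S, b i := by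
  induction S using Finset.induction_on_max_value d with
  | empty => exact fun w ↦ ⟨0, ∅, by simp⟩
  | insert i S hi hmax ih =>
    intro w
    obtain ⟨u, hu, humin⟩ := (e i).exists_min_image w (hne i)
    -- The deepest set `e i` gets multiplicity `w u`, its least weight, which is charged to all its
    -- points.
    set w' : V → ℕ := fun v ↦ if v ∈ e i then w v - w u else w v with hw'
    obtain ⟨b, D, hD, hb, hbD⟩ := ih w'
    -- One point `v` can replace all of `D ∩ e i` without raising the `w'`-cost. The new cover then
    -- meets `e i` only once, so passing back to `w` adds exactly `w u`.
    have hcover : ∃ v ∈ e i, (∀ j ∈ S, ∀ x ∈ e i, x ∈ D → x ∈ e j → v ∈ e j) ∧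
        ∑ x ∈ D \ e i, w' x + w' v ≤ ∑ x ∈ D, w' x := by
      rcases (D ∩ e i).eq_empty_or_nonempty with h0 | h0
      · refine ⟨u, hu, fun j _ x hx hxD ↦ ?_, ?_⟩
        · exact absurd (mem_inter.2 ⟨hxD, hx⟩) (by simp [h0])
        · have : D \ e i = D := sdiff_eq_self_iff_disjoint.2 (disjoint_iff_inter_eq_empty.2 h0)
          simp [this, hw', hu]
      -- By the chain condition, a point in the most sets lies in every set that the others meet.
      · obtain ⟨v, hv, hvmax⟩ :=
          (D ∩ e i).exists_max_image (fun x ↦ #{j ∈ S | x ∈ e j}) h0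
        rw [mem_inter] at hv
        refine ⟨v, hv.2, fun j hj x hx hxD hxj ↦ ?_, ?_⟩
        · rcases hnest i x hx v hv.2 with h | h
          · exact h j (hmax j hj) hxj
          · have hsub : {j ∈ S | v ∈ e j} ⊆ {j ∈ S | x ∈ e j} := fun k hk ↦ by
              rw [mem_filter] at hk ⊢
              exact ⟨hk.1, h k (hmax k hk.1) hk.2⟩
            have heq := eq_of_subset_of_card_le hsub (hvmax x (mem_inter.2 ⟨hxD, hx⟩))
            have : j ∈ {j ∈ S | v ∈ e j} := heq ▸ mem_filter.2 ⟨hj, hxj⟩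
            exact (mem_filter.1 this).2
        · rw [← sum_sdiff (inter_subset_left : D ∩ e i ⊆ D), sdiff_inter_self_left]
          gcongr
          exact single_le_sum (f := w') (fun _ _ ↦ Nat.zero_le _) (mem_inter.2 hv)
    obtain ⟨v, hv, hvS, hvD⟩ := hcover
    have hbi : ∀ T ⊆ S, ∑ j ∈ T, Function.update b i (w u) j = ∑ j ∈ T, b j := fun T hT ↦
      sum_congr rfl fun j hj ↦ Function.update_of_ne (ne_of_mem_of_not_mem (hT hj) hi) _ _
    refine ⟨Function.update b i (w u), insert v (D \ e i), fun j hj ↦ ?_, fun x ↦ ?_, ?_⟩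
    · rcases mem_insert.1 hj with rfl | hj
      · exact ⟨v, hv, mem_insert_self _ _⟩
      · obtain ⟨x, hx, hxD⟩ := hD j hj
        by_cases hxi : x ∈ e i
        · exact ⟨v, hvS j hj x hxi hxD hx, mem_insert_self _ _⟩
        · exact ⟨x, hx, mem_insert_of_mem (mem_sdiff.2 ⟨hxD, hxi⟩)⟩
    · have hx := hb x
      rw [filter_insert]
      split_ifs with hxi
      · rw [sum_insert (by simp [hi]), hbi _ (filter_subset _ _), Function.update_self]
        have := humin x hxi
        simp only [hw', hxi, if_true] at hx
        omega
      · rw [hbi _ (filter_subset _ _)]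
        simpa [hw', hxi] using hx
    · rw [sum_insert (by simp [hv]), sum_insert hi, hbi _ subset_rfl, Function.update_self]
      have h1 : ∑ x ∈ D \ e i, w x = ∑ x ∈ D \ e i, w' x :=
        sum_congr rfl fun x hx ↦ by simp [hw', (mem_sdiff.1 hx).2]
      have h2 : w' v = w v - w u := by simp [hw', hv]
      have := humin v hv
      omega

namespace SimpleGraph

variable {V : Type*} {G : SimpleGraph V}

/-- Such a neighbor is the parent of `v`, the penultimate vertex of the path from `r`: a neighbor
off that path would be one step farther from `r`. -/
theorem IsTree.eq_of_adj_of_dist_le (hG : G.IsTree) (r : V) {v w w' : V} (h : G.Adj v w)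
    (h' : G.Adj v w') (hd : G.dist r w ≤ G.dist r v) (hd' : G.dist r w' ≤ G.dist r v) :
    w = w' := by
  obtain ⟨q, hq, hql⟩ := (hG.connected r v).exists_path_of_dist
  have key : ∀ x, G.Adj v x → G.dist r x ≤ G.dist r v → x = q.penultimate := by
    intro x hx hxd
    refine hG.isAcyclic.eq_penultimate_of_adj_end hq hx ?_
    by_contra hxq
    obtain ⟨p, hp, hpl⟩ := (hG.connected r x).exists_path_of_dist
    have hv := hG.isAcyclic.mem_support_of_ne_mem_support_of_adj_of_isPath hp hq hx.symm hxq
    have := congrArg Walk.length (hG.isAcyclic.path_concat hq hp hx hv)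
    rw [Walk.length_concat] at this
    omega
  rw [key w h hd, key w' h' hd']

variable [Fintype V] [DecidableEq V] [DecidableRel G.Adj]

theorem mem_closedNeighborhood {u v : V} : u ∈ G.closedNeighborhood v ↔ u = v ∨ G.Adj v u := by
  simp [closedNeighborhood]

/-- No deeper than `i`, a child of `i` lies only in `N[i]`, and `i` only in `N[i]` and its parent's
neighborhood, both of which contain the parent. So the chain runs child, `i`, parent. -/
theorem IsTree.closedNeighborhood_nested (hG : G.IsTree) (r i : V) {u v : V}
    (hu : u ∈ G.closedNeighborhood i) (hv : v ∈ G.closedNeighborhood i) :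
    (∀ j, G.dist r j ≤ G.dist r i → u ∈ G.closedNeighborhood j → v ∈ G.closedNeighborhood j) ∨
      (∀ j, G.dist r j ≤ G.dist r i →
        v ∈ G.closedNeighborhood j → u ∈ G.closedNeighborhood j) := by
  have child : ∀ x y, G.Adj i x → G.dist r i < G.dist r x → y ∈ G.closedNeighborhood i →
      ∀ j, G.dist r j ≤ G.dist r i → x ∈ G.closedNeighborhood j →
        y ∈ G.closedNeighborhood j := by
    intro x y hx hd hy j hj hxj
    rcases mem_closedNeighborhood.1 hxj with rfl | hxj
    · omega
    · rwa [hG.eq_of_adj_of_dist_le r hxj.symm hx.symm (by omega) (by omega)]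
  have self : ∀ y, G.Adj i y → G.dist r y ≤ G.dist r i →
      ∀ j, G.dist r j ≤ G.dist r i → i ∈ G.closedNeighborhood j →
        y ∈ G.closedNeighborhood j := by
    intro y hy hd j hj hij
    rcases mem_closedNeighborhood.1 hij with rfl | hij
    · exact mem_closedNeighborhood.2 (.inr hy)
    · exact mem_closedNeighborhood.2 (.inl (hG.eq_of_adj_of_dist_le r hy hij.symm hd hj))
  rcases mem_closedNeighborhood.1 hu with rfl | hu'
  · rcases mem_closedNeighborhood.1 hv with rfl | hv'
    · exact .inl fun _ _ h ↦ h
    · rcases le_or_gt (G.dist r v) (G.dist r u) with h | h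
      · exact .inl (self v hv' h)
      · exact .inr (child v u hv' h hu)
  · rcases le_or_gt (G.dist r u) (G.dist r i) with h | h
    · rcases mem_closedNeighborhood.1 hv with rfl | hv'
      · exact .inr (self u hu' h)
      · rcases le_or_gt (G.dist r v) (G.dist r i) with h' | h'
        · rw [hG.eq_of_adj_of_dist_le r hu' hv' h h']
          exact .inl fun _ _ h ↦ h
        · exact .inr (child v u hv' h' hu)
    · exact .inl (child u v hu' h hv)

end SimpleGraph

namespace MvPolynomial

variable {σ K : Type*} [Field K]

/-- The ideal of polynomials all of whose monomials have weight at least `n`. -/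
noncomputable def orderIdeal (K : Type*) [Field K] (w : σ → ℕ) (n : ℕ) :
    Ideal (MvPolynomial σ K) where
  carrier := {f | (n : ℕ∞) ≤ (f : MvPowerSeries σ K).weightedOrder w}
  add_mem' {f g} hf hg := by
    simp only [Set.mem_ofPred_eq, coe_add] at *
    exact (le_min hf hg).trans (MvPowerSeries.min_weightedOrder_le_add w)
  zero_mem' := by simp
  smul_mem' c f hf := by
    simp only [Set.mem_ofPred_eq, smul_eq_mul, coe_mul, MvPowerSeries.weightedOrder_mul] at *
    exact le_add_left hf

variable {w : σ → ℕ} {m n : ℕ} {f g : MvPolynomial σ K}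

theorem mem_orderIdeal :
    f ∈ orderIdeal K w n ↔ (n : ℕ∞) ≤ (f : MvPowerSeries σ K).weightedOrder w := Iff.rfl

theorem mem_orderIdeal_iff_support :
    f ∈ orderIdeal K w n ↔ ∀ d ∈ f.support, n ≤ Finsupp.weight w d := by
  rw [mem_orderIdeal]
  constructor
  · intro h d hd
    rw [mem_support_iff, ← coeff_coe] at hd
    exact_mod_cast h.trans (MvPowerSeries.weightedOrder_le w hd)
  · intro h
    refine MvPowerSeries.nat_le_weightedOrder w fun d hd ↦ ?_
    rw [coeff_coe]
    by_contra hne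
    exact absurd (h d (mem_support_iff.2 hne)) (by omega)

theorem X_mem_orderIdeal_one {v : σ} : (X v : MvPolynomial σ K) ∈ orderIdeal K w 1 ↔ w v ≠ 0 := by
  simp [mem_orderIdeal_iff_support, support_X, Finsupp.weight_single, Nat.one_le_iff_ne_zero]

theorem orderIdeal_mul_le : orderIdeal K w m * orderIdeal K w n ≤ orderIdeal K w (m + n) := by
  refine Ideal.mul_le.2 fun f hf g hg ↦ ?_
  rw [mem_orderIdeal] at *
  rw [coe_mul, MvPowerSeries.weightedOrder_mul, Nat.cast_add]
  exact add_le_add hf hg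

theorem pow_le_orderIdeal {I : Ideal (MvPolynomial σ K)} (h : I ≤ orderIdeal K w 1) (k : ℕ) :
    I ^ k ≤ orderIdeal K w k := by
  induction k with
  | zero => intro f _; simp [mem_orderIdeal]
  | succ k ih => exact pow_succ I k ▸ (Ideal.mul_mono ih h).trans orderIdeal_mul_le

/-- If a prime ideal is the colon ideal of `orderIdeal K w n` by a polynomial, then it is
`orderIdeal K w 1`. -/
theorem eq_orderIdeal_one_of_isPrime {p : Ideal (MvPolynomial σ K)} (hp : p.IsPrime)
    (h : ∀ g, g ∈ p ↔ g * f ∈ orderIdeal K w n) : p = orderIdeal K w 1 := by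
  have hf : ¬ (n : ℕ∞) ≤ (f : MvPowerSeries σ K).weightedOrder w := fun hf ↦
    hp.ne_top ((Ideal.eq_top_iff_one p).2 ((h 1).2 (by simpa [mem_orderIdeal] using hf)))
  -- Order is additive on products and `f` has order below `n`, so `g * f` of order at least `n`
  -- forces `g` to have positive order; conversely `g ^ n * f` has order at least `n`.
  refine le_antisymm (fun g hg ↦ ?_) (fun g hg ↦ hp.mem_of_pow_mem n ((h _).2 ?_))
  · rw [h, mem_orderIdeal, coe_mul, MvPowerSeries.weightedOrder_mul] at hg
    rw [mem_orderIdeal, Nat.cast_one, Order.one_le_iff_ne_zero]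
    intro h0
    rw [h0, zero_add] at hg
    exact hf hg
  · exact Ideal.mul_mem_right _ _
      (pow_le_orderIdeal (I := orderIdeal K w 1) le_rfl n (Ideal.pow_mem_pow hg n))

/-- An associated prime of a finite intersection of ideals `orderIdeal K (w c) n` is one of the
ideals `orderIdeal K (w c) 1`. -/
theorem exists_eq_orderIdeal_one_of_mem_associatedPrimes [Finite σ] {ι : Type*} (s : Finset ι)
    (w : ι → σ → ℕ) {J p : Ideal (MvPolynomial σ K)} (hJ : J = s.inf fun c ↦ orderIdeal K (w c) n)
    (hp : p ∈ associatedPrimes (MvPolynomial σ K) (MvPolynomial σ K ⧸ J)) :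
    ∃ c ∈ s, p = orderIdeal K (w c) 1 := by
  obtain ⟨hprime, x, hx⟩ := Submodule.isAssociatedPrime_iff.1 hp
  obtain ⟨f, rfl⟩ := Ideal.Quotient.mk_surjective x
  have hmem : ∀ g, g ∈ p ↔ g * f ∈ J := fun g ↦ by
    rw [hx, Submodule.mem_colon_singleton, Submodule.mem_bot, ← Ideal.Quotient.eq_zero_iff_mem,
      map_mul]
    rfl
  have hinf : s.inf (fun c ↦ (orderIdeal K (w c) n).colon {f}) = p := by
    ext g
    rw [hmem, hJ]
    simp [Submodule.mem_finsetInf, Submodule.mem_colon_singleton]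
  obtain ⟨c, hc, hcp⟩ := Ideal.eq_inf_of_isPrime_inf (hinf ▸ hprime)
  refine ⟨c, hc, eq_orderIdeal_one_of_isPrime (n := n) (f := f) hprime fun g ↦ ?_⟩
  rw [← hinf, ← hcp, Submodule.mem_colon_singleton, smul_eq_mul]

end MvPolynomial

namespace MvPolynomial

variable {V ι K : Type*} [Field K] {e : ι → Finset V}

/-- The indicator function of a finite set, as a weight on the variables. -/
def coverWeight [DecidableEq V] (C : Finset V) (v : V) : ℕ := if v ∈ C then 1 else 0

variable [DecidableEq V]

theorem weight_coverWeight [Fintype V] (C : Finset V) (d : V →₀ ℕ) :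
    Finsupp.weight (coverWeight C) d = ∑ v ∈ C, d v := by
  rw [Finsupp.weight_apply, Finsupp.sum_fintype _ _ (by simp)]
  simp [coverWeight]

theorem orderIdeal_coverWeight_le {C : Finset V} {p : Ideal (MvPolynomial V K)}
    (h : ∀ v ∈ C, X v ∈ p) : orderIdeal K (coverWeight C) 1 ≤ p := by
  have hle : Ideal.span ((X : V → MvPolynomial V K) '' (C : Set V)) ≤ p :=
    Ideal.span_le.2 (by rintro _ ⟨v, hv, rfl⟩; exact h v hv)
  refine fun f hf ↦ hle (mem_ideal_span_X_image.2 fun d hd ↦ ?_)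
  by_contra! hd0
  have hw := mem_orderIdeal_iff_support.1 hf d hd
  have h0 : Finsupp.weight (coverWeight C) d = 0 := by
    rw [Finsupp.weight_apply]
    refine Finset.sum_eq_zero fun v _ ↦ ?_
    by_cases hv : v ∈ C
    · simp [hd0 v hv]
    · simp [coverWeight, hv]
  omega

theorem span_prod_X_le_orderIdeal {C : Finset V} (hC : ∀ i, ∃ v ∈ e i, v ∈ C) :
    Ideal.span (Set.range fun i ↦ ∏ j ∈ e i, (X j : MvPolynomial V K)) ≤
      orderIdeal K (coverWeight C) 1 := by
  rw [Ideal.span_le]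
  rintro _ ⟨i, rfl⟩
  obtain ⟨v, hv, hvC⟩ := hC i
  exact Ideal.mem_of_dvd _ (Finset.dvd_prod_of_mem _ hv)
    (X_mem_orderIdeal_one.2 (by simp [coverWeight, hvC]))

/-- The variables in a prime over the edge ideal form a cover; if the prime lies below that of `C`,
minimality makes this cover equal to `C`. -/
theorem orderIdeal_coverWeight_mem_minimalPrimes {C : Finset V} [Fintype V]
    (hC : Minimal (fun C : Finset V ↦ ∀ i, ∃ v ∈ e i, v ∈ C) C)
    (hprime : (orderIdeal K (coverWeight C) 1).IsPrime) :
    orderIdeal K (coverWeight C) 1 ∈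
      (Ideal.span (Set.range fun i ↦ ∏ j ∈ e i, (X j : MvPolynomial V K))).minimalPrimes := by
  classical
  refine ⟨⟨hprime, span_prod_X_le_orderIdeal hC.prop⟩, fun q ⟨hq, hIq⟩ hqC ↦ ?_⟩
  have hcov : ∀ i, ∃ v ∈ e i, v ∈ ({v | X v ∈ q} : Finset V) := fun i ↦ by
    obtain ⟨v, hv, hvq⟩ := hq.prod_mem_iff.1 (hIq (Ideal.subset_span ⟨i, rfl⟩))
    exact ⟨v, hv, by simpa using hvq⟩
  have hsub : ({v | X v ∈ q} : Finset V) ≤ C := fun v hv ↦ by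
    have := X_mem_orderIdeal_one.1 (hqC (Finset.mem_filter.1 hv).2)
    by_contra hvC
    simp [coverWeight, hvC] at this
  exact orderIdeal_coverWeight_le fun v hv ↦ (Finset.mem_filter.1 (hC.le_of_le hcov hsub hv)).2

theorem monomial_mem_span_prod_X_pow [Fintype V] [Fintype ι] (b : ι → ℕ) (d : V →₀ ℕ) (a : K)
    (hb : ∀ v, ∑ i with v ∈ e i, b i ≤ d v) :
    monomial d a ∈
      Ideal.span (Set.range fun i ↦ ∏ j ∈ e i, (X j : MvPolynomial V K)) ^ (∑ i, b i) := by
  have hmem : ∏ i, (∏ j ∈ e i, (X j : MvPolynomial V K)) ^ b i ∈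
      Ideal.span (Set.range fun i ↦ ∏ j ∈ e i, (X j : MvPolynomial V K)) ^ (∑ i, b i) := by
    rw [← Finset.prod_pow_eq_pow_sum]
    exact Ideal.prod_mem_prod fun i _ ↦ Ideal.pow_mem_pow (Ideal.subset_span (Set.mem_range_self i)) _
  refine Ideal.mem_of_dvd _ ?_ hmem
  have hprod : ∏ i, (∏ j ∈ e i, (X j : MvPolynomial V K)) ^ b i =
      ∏ v, (X v : MvPolynomial V K) ^ ∑ i with v ∈ e i, b i := by
    simp_rw [← Finset.prod_pow_eq_pow_sum, Finset.prod_filter, ← Finset.prod_pow]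
    rw [Finset.prod_comm]
    simp [Finset.prod_ite_mem]
  rw [hprod, monomial_eq, Finsupp.prod_fintype _ _ (by simp)]
  exact dvd_mul_of_dvd_right (Finset.prod_dvd_prod_of_dvd _ _ fun v _ ↦ pow_dvd_pow _ (hb v)) _

/-- If weighted packing equals weighted covering for the family `e`, then the powers of its edge
ideal are the intersections of the corresponding powers of its minimal primes. -/
theorem span_prod_X_pow_eq_inf [Fintype V] [Fintype ι]
    (he : ∀ w : V → ℕ, ∃ (b : ι → ℕ) (D : Finset V), (∀ i, ∃ v ∈ e i, v ∈ D) ∧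
      (∀ v, ∑ i with v ∈ e i, b i ≤ w v) ∧ ∑ v ∈ D, w v ≤ ∑ i, b i)
    (s : Finset (Finset V))
    (hs : ∀ C, C ∈ s ↔ Minimal (fun C : Finset V ↦ ∀ i, ∃ v ∈ e i, v ∈ C) C) (k : ℕ) :
    Ideal.span (Set.range fun i ↦ ∏ j ∈ e i, (X j : MvPolynomial V K)) ^ k =
      s.inf fun C ↦ orderIdeal K (coverWeight C) k := by
  refine le_antisymm (Finset.le_inf fun C hC ↦
    pow_le_orderIdeal (span_prod_X_le_orderIdeal ((hs C).1 hC).prop) k) fun f hf ↦ ?_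
  rw [f.as_sum]
  refine Ideal.sum_mem _ fun d hd ↦ ?_
  obtain ⟨b, D, hD, hb, hbD⟩ := he d
  obtain ⟨C, hCD, hC⟩ := exists_minimal_le_of_wellFoundedLT
    (fun C : Finset V ↦ ∀ i, ∃ v ∈ e i, v ∈ C) D hD
  have hfC := mem_orderIdeal_iff_support.1 ((Submodule.mem_finsetInf.1 hf) C ((hs C).2 hC)) d hd
  rw [weight_coverWeight] at hfC
  exact Ideal.pow_le_pow_right (hfC.trans ((Finset.sum_le_sum_of_subset hCD).trans hbD))
    (monomial_mem_span_prod_X_pow b d _ hb)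

/-- If weighted packing equals weighted covering for the family `e`, then the associated primes of
the powers of its edge ideal are its minimal primes. -/
theorem associatedPrimes_quotient_span_prod_X_pow [Fintype V] [Fintype ι]
    (he : ∀ w : V → ℕ, ∃ (b : ι → ℕ) (D : Finset V), (∀ i, ∃ v ∈ e i, v ∈ D) ∧
      (∀ v, ∑ i with v ∈ e i, b i ≤ w v) ∧ ∑ v ∈ D, w v ≤ ∑ i, b i) {k : ℕ} (hk : k ≠ 0) :
    associatedPrimes (MvPolynomial V K) (MvPolynomial V K ⧸
        Ideal.span (Set.range fun i ↦ ∏ j ∈ e i, (X j : MvPolynomial V K)) ^ k) =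
      (Ideal.span (Set.range fun i ↦ ∏ j ∈ e i, (X j : MvPolynomial V K))).minimalPrimes := by
  classical
  refine Set.Subset.antisymm (fun p hp ↦ ?_) ?_
  · obtain ⟨C, hC, rfl⟩ := exists_eq_orderIdeal_one_of_mem_associatedPrimes
      {C | Minimal (fun C : Finset V ↦ ∀ i, ∃ v ∈ e i, v ∈ C) C} coverWeight
      (span_prod_X_pow_eq_inf he _ (fun C ↦ by simp) k) hp
    exact orderIdeal_coverWeight_mem_minimalPrimes (Finset.mem_filter.1 hC).2 hp.isPrime
  -- An ideal and its powers share a radical, hence minimal primes, and these are always associated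
  -- over a Noetherian ring.
  · rw [← Ideal.radical_minimalPrimes, ← Ideal.radical_pow _ hk, Ideal.radical_minimalPrimes]
    conv_lhs => rw [← Ideal.annihilator_quotient (I := _ ^ k)]
    exact Module.associatedPrimes.minimalPrimes_annihilator_subset_associatedPrimes _ _

end MvPolynomial

theorem corollary2 (K : Type*) [Field K] {V : Type*} [Fintype V] [DecidableEq V]
    (G : SimpleGraph V) [DecidableRel G.Adj] (hG : G.IsTree) :
    (G.closedNeighborhoodIdeal K).IsNormallyTorsionFree ∧
      ∀ k : ℕ, 1 ≤ k →
        associatedPrimes (MvPolynomial V K)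
            (MvPolynomial V K ⧸ (G.closedNeighborhoodIdeal K) ^ k) =
          (G.closedNeighborhoodIdeal K).minimalPrimes := by
  obtain ⟨r⟩ := hG.connected.nonempty
  have hmin : ∀ k : ℕ, 1 ≤ k → associatedPrimes (MvPolynomial V K)
      (MvPolynomial V K ⧸ (G.closedNeighborhoodIdeal K) ^ k) =
        (G.closedNeighborhoodIdeal K).minimalPrimes := fun k hk ↦
    MvPolynomial.associatedPrimes_quotient_span_prod_X_pow (fun w ↦ by
      simpa using exists_packing_cover_of_nested G.closedNeighborhood (G.dist r)
        (fun i ↦ ⟨i, SimpleGraph.mem_closedNeighborhood.2 (.inl rfl)⟩)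
        (fun i u hu v hv ↦ hG.closedNeighborhood_nested r i hu hv) Finset.univ w)
      (Nat.one_le_iff_ne_zero.1 hk)
  refine ⟨fun k hk ↦ ?_, hmin⟩
  have h1 := hmin 1 le_rfl
  rw [pow_one] at h1
  rw [hmin k hk, h1]
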